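/- There exists an infinite sequence $Y_0, Y_1, Y_2, \dots$ of closed connected orientable smooth $3$-manifolds such that the products $M_i = Y_i \times \mathbb{R}^4$ are pairwise non-homeomorphic non-compact smooth $7$-manifolds without boundary and, for every $i$, the following holds. The manifold $M_i$ admits a spin structure, and it carries a co-oriented contact structure $\xi_i$, i.e. a hyperplane field $\xi_i = \ker \beta_i$ for some smooth $1$-form $\beta_i$ on $M_i$ such that $\beta_i \wedge (d\beta_i)^3$ vanishes nowhere. Moreover, $Y_i \times \{0\} \subset M_i$ is a co-oriented contact submanifold of $(M_i, \xi_i)$ of codimension four, i.e. $T(Y_i \times \{0\}) \cap \xi_i$ is the kernel of a smooth $1$-form $\alpha_i$ on $Y_i \times \{0\}$ such that $\alpha_i \wedge d\alpha_i$ vanishes nowhere; and $M_i$ retracts onto $Y_i \times \{0\}$, by a smooth retraction which is homotopic to the identity of $M_i$ relative to $Y_i \times \{0\}$. In particular, there exist infinitely many pairwise distinct non-closed spin $7$-manifolds that admit co-oriented contact structures and retract onto co-oriented contact submanifolds of codimension four. -/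

import Mathlib

open scoped Manifold ContDiff

noncomputable section

namespace ContactSpin

/-! ### Wedge products of alternating forms -/

/-- The wedge product of two alternating forms: the signed sum over shuffles of
`a (v ∘ inl) * b (v ∘ inr)`. -/
def wedge {V : Type*} [AddCommGroup V] [Module ℝ V] {k l : ℕ}
    (a : V [⋀^Fin k]→ₗ[ℝ] ℝ) (b : V [⋀^Fin l]→ₗ[ℝ] ℝ) : V [⋀^Fin (k + l)]→ₗ[ℝ] ℝ :=
  ((LinearMap.mul' ℝ ℝ).compAlternatingMap (a.domCoprod b)).domDomCongr finSumFinEquiv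

/-- The `n`-th wedge power of an alternating `2`-form. -/
def wedgePow {V : Type*} [AddCommGroup V] [Module ℝ V] (b : V [⋀^Fin 2]→ₗ[ℝ] ℝ) :
    (n : ℕ) → V [⋀^Fin (2 * n)]→ₗ[ℝ] ℝ
  | 0 => (AlternatingMap.constOfIsEmpty ℝ V (Fin 0) (1 : ℝ) : V [⋀^Fin 0]→ₗ[ℝ] ℝ)
  | n + 1 => wedge (wedgePow b n) b

universe u

section Manifolds

variable {E : Type*} [NormedAddCommGroup E] [NormedSpace ℝ E]
  {H : Type*} [TopologicalSpace H] (I : ModelWithCorners ℝ E H)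
  {M : Type u} [TopologicalSpace M] [ChartedSpace H M]

/-! ### Differential one-forms and contact structures -/

variable (M) in
/-- A (not necessarily smooth) field of covectors on `M`. -/
abbrev CovectorField : Type _ := (p : M) → TangentSpace I p →L[ℝ] ℝ

variable {I}

/-- A covector field is a smooth `1`-form if it is smooth as a (fibrewise linear) function on the
tangent bundle. -/
def IsSmoothOneForm [IsManifold I 1 M] (α : CovectorField I M) : Prop :=
  ContMDiff I.tangent 𝓘(ℝ, ℝ) ∞ (fun v : TangentBundle I M => α v.1 v.2)

/-- The expression of a covector field in the preferred chart at `p`: the pullback of `α` under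
the inverse chart, as a `1`-form on the model space. -/
def chartForm (α : CovectorField I M) (p : M) (x : E) : E [⋀^Fin 1]→L[ℝ] ℝ :=
  ContinuousAlternatingMap.ofSubsingleton ℝ E ℝ (0 : Fin 1)
    ((α ((extChartAt I p).symm x)).comp
      (mfderivWithin 𝓘(ℝ, E) I (extChartAt I p).symm (Set.range I) x : E →L[ℝ] _))

/-- The exterior derivative of a `1`-form at `p`: the exterior derivative of its expression in the
preferred chart at `p`, pulled back under that chart. -/
def extDerivAt (α : CovectorField I M) (p : M) : TangentSpace I p [⋀^Fin 2]→L[ℝ] ℝ :=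
  (extDerivWithin (chartForm α p) (Set.range I) (extChartAt I p p)).compContinuousLinearMap
    (mfderiv I 𝓘(ℝ, E) (extChartAt I p) p : TangentSpace I p →L[ℝ] E)

/-- `α` is a contact form on the `(2 n + 1)`-dimensional manifold `M`: a smooth `1`-form such that
`α ∧ (dα)ⁿ` vanishes at no point. -/
structure IsContactForm [IsManifold I 1 M] (n : ℕ) (α : CovectorField I M) : Prop where
  finrank_eq : Module.finrank ℝ E = 2 * n + 1
  smooth : IsSmoothOneForm α
  wedge_ne_zero (p : M) :
    wedge (AlternatingMap.ofSubsingleton ℝ (TangentSpace I p) ℝ (0 : Fin 1)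
        (α p : TangentSpace I p →ₗ[ℝ] ℝ))
      (wedgePow (extDerivAt α p).toAlternatingMap n) ≠ 0

/-- A co-oriented contact structure on a `(2 n + 1)`-dimensional manifold: a field of subspaces of
the tangent spaces that is the kernel of a globally defined contact form. -/
def IsCoorientedContactStructure [IsManifold I 1 M] (n : ℕ)
    (ξ : (p : M) → Submodule ℝ (TangentSpace I p)) : Prop :=
  ∃ α : CovectorField I M, IsContactForm n α ∧
    ∀ p, ξ p = LinearMap.ker (α p : TangentSpace I p →ₗ[ℝ] ℝ)

/-- `f : Y → M` exhibits `Y` as a co-oriented contact submanifold of dimension `2 m + 1` of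
`(M, ξ)`: it is a smooth embedding, and the distribution `TY ∩ ξ`, that is `(df)⁻¹ ξ`, is a
co-oriented contact structure on `Y`. -/
def IsCoorientedContactSubmanifold {E' : Type*} [NormedAddCommGroup E'] [NormedSpace ℝ E']
    {H' : Type*} [TopologicalSpace H'] {J : ModelWithCorners ℝ E' H'}
    {Y : Type*} [TopologicalSpace Y] [ChartedSpace H' Y] [IsManifold J 1 Y]
    (m : ℕ) (ξ : (p : M) → Submodule ℝ (TangentSpace I p)) (f : Y → M) : Prop :=
  Manifold.IsSmoothEmbedding J I ∞ f ∧
    IsCoorientedContactStructure (I := J) m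
      (fun y => (ξ (f y)).comap (mfderiv J I f y : TangentSpace J y →ₗ[ℝ] TangentSpace I (f y)))

variable (I)

/-! ### Orientability and spin structures -/

variable (M) in
/-- An `n`-dimensional manifold is orientable if its tangent spaces can be oriented in such a way
that every point has a neighbourhood with a smooth local frame that is positively oriented at each
of its points. -/
def IsOrientable [IsManifold I 1 M] (n : ℕ) : Prop :=
  ∃ o : (p : M) → Orientation ℝ (TangentSpace I p) (Fin n),
    ∀ p : M, ∃ U : Set M, IsOpen U ∧ p ∈ U ∧
      ∃ s : Fin n → (q : M) → TangentSpace I q,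
        IsLocalFrameOn (V := fun q : M => TangentSpace I q) I E ∞ s U ∧
        ∀ q ∈ U, ∃ b : Module.Basis (Fin n) ℝ (TangentSpace I q),
          (∀ k, b k = s k q) ∧ b.orientation = o q

/-- The standard quadratic form `v ↦ ∑ₖ vₖ²` on `ℝⁿ`. -/
abbrev stdForm (n : ℕ) : QuadraticForm ℝ (Fin n → ℝ) :=
  QuadraticMap.weightedSumSquares ℝ (fun _ : Fin n => (1 : ℝ))

/-- The topology of the finite-dimensional real vector space underlying the Clifford algebra
of `ℝⁿ`; it induces the usual topology on `Spin(n)`. -/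
instance cliffordTopology (n : ℕ) : TopologicalSpace (CliffordAlgebra (stdForm n)) :=
  moduleTopology ℝ (CliffordAlgebra (stdForm n))

/-- The matrix `A` is the image of `g ∈ Spin(n)` under the double covering `Spin(n) → SO(n)`:
`g v g⁻¹ = A v` for all `v ∈ ℝⁿ`. -/
def SpinCovers {n : ℕ} (g : CliffordAlgebra (stdForm n)) (A : Matrix (Fin n) (Fin n) ℝ) : Prop :=
  ∀ v : Fin n → ℝ,
    g * CliffordAlgebra.ι (stdForm n) v = CliffordAlgebra.ι (stdForm n) (A.mulVec v) * g

variable (M) in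
/-- A spin structure on an `n`-dimensional manifold, given by cocycles: smooth local frames of the
tangent bundle over an open cover, whose transition matrices (which lie in `SO(n)`, so that the
frames define an orientation and a Riemannian metric for which they are oriented and orthonormal)
are lifted to a continuous `Spin(n)`-valued cocycle. -/
structure SpinStructure [IsManifold I 1 M] (n : ℕ) where
  /-- The index set of the cover. -/
  index : Type u
  /-- The open cover. -/
  U : index → Set M
  isOpen_U (i : index) : IsOpen (U i)
  iUnion_U : ⋃ i, U i = Set.univ
  /-- The local frames. -/
  frame : index → Fin n → (q : M) → TangentSpace I q
  isLocalFrameOn (i : index) :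
    IsLocalFrameOn (V := fun q : M => TangentSpace I q) I E ∞ (frame i) (U i)
  /-- The lifted transition functions. -/
  lift : index → index → M → CliffordAlgebra (stdForm n)
  lift_mem (i j : index) : ∀ q ∈ U i ∩ U j, lift i j q ∈ spinGroup (stdForm n)
  continuousOn_lift (i j : index) : ContinuousOn (lift i j) (U i ∩ U j)
  lift_mul_lift (i j k : index) :
    ∀ q ∈ U i ∩ U j ∩ U k, lift i j q * lift j k q = lift i k q
  lift_covers (i j : index) : ∀ q ∈ U i ∩ U j, ∃ A : Matrix (Fin n) (Fin n) ℝ,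
    SpinCovers (lift i j q) A ∧ ∀ k, frame j k q = ∑ l, A l k • frame i l q

variable (M) in
/-- The `n`-dimensional manifold `M` admits a spin structure. -/
def AdmitsSpinStructure [IsManifold I 1 M] (n : ℕ) : Prop :=
  Nonempty (SpinStructure I M n)

end Manifolds

end ContactSpin

end

/-! Take for `Y` the Heisenberg nilmanifolds: quotients of `ℝ³` by the integral Heisenberg group
with parameter `k = i + 1`, acting by affine shears that are free, properly discontinuous and
cocompact. Everything geometric is written down on `ℝ³` or `ℝ³ × ℝ⁴` and descends because it is
invariant under deck transformations. The form `α = dz - k x dy` is an invariant contact form, and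
so is `β = α + u₀ du₁ + u₂ du₃` on the product. As `β` restricts to `α` on `u = 0`, the zero section
is a contact submanifold, and scaling `ℝ⁴` retracts onto it. An invariant global frame gives
orientability, and on the product a spin structure with trivial cocycle. The products are told apart
by `π₁`, which is the Heisenberg group because `ℝ³ × ℝ⁴` is simply connected. Its centre consists of
the `(0, 0, c)`, its commutator subgroup of those with `k ∣ c`; hence `|k|` is the exponent of
centre modulo commutators and an isomorphism invariant (`forall_center_pow_mem_commutator_iff`,
`eq_of_homeomorph`). Descent is carried by `IsUniformization`, nondegeneracy by
`wedge_wedgePow_three_ne_zero`. -/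

namespace ContactSpin

/-! ### Integral Heisenberg groups and the invariant that recovers `|k|`. -/

/-- The integral Heisenberg group with commutator parameter `k`: triples of integers with
`(a, b, c) * (a', b', c') = (a + a', b + b', c + c' + k * a * b')`. -/
@[ext]
structure Heisenberg (k : ℤ) where
  /-- The first coordinate. -/
  a : ℤ
  /-- The second coordinate. -/
  b : ℤ
  /-- The central coordinate. -/
  c : ℤ

namespace Heisenberg

variable {k : ℤ}

instance : Mul (Heisenberg k) := ⟨fun g h => ⟨g.a + h.a, g.b + h.b, g.c + h.c + k * g.a * h.b⟩⟩
instance : One (Heisenberg k) := ⟨⟨0, 0, 0⟩⟩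
instance : Inv (Heisenberg k) := ⟨fun g => ⟨-g.a, -g.b, -g.c + k * g.a * g.b⟩⟩

@[simp] lemma mul_a (g h : Heisenberg k) : (g * h).a = g.a + h.a := rfl
@[simp] lemma mul_b (g h : Heisenberg k) : (g * h).b = g.b + h.b := rfl
@[simp] lemma mul_c (g h : Heisenberg k) : (g * h).c = g.c + h.c + k * g.a * h.b := rfl
@[simp] lemma one_a : (1 : Heisenberg k).a = 0 := rfl
@[simp] lemma one_b : (1 : Heisenberg k).b = 0 := rfl
@[simp] lemma one_c : (1 : Heisenberg k).c = 0 := rfl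
@[simp] lemma inv_a (g : Heisenberg k) : g⁻¹.a = -g.a := rfl
@[simp] lemma inv_b (g : Heisenberg k) : g⁻¹.b = -g.b := rfl
@[simp] lemma inv_c (g : Heisenberg k) : g⁻¹.c = -g.c + k * g.a * g.b := rfl

instance : Group (Heisenberg k) :=
  Group.ofLeftAxioms
    (fun g h l => by ext <;> simp <;> ring)
    (fun g => by ext <;> simp)
    (fun g => by ext <;> simp)

/-- The reduction of the central coordinate modulo `k`, a homomorphism. -/
def reduceCentral (k : ℤ) : Heisenberg k →* Multiplicative (ZMod k.natAbs) where
  toFun g := Multiplicative.ofAdd (g.c : ZMod k.natAbs)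
  map_one' := by simp
  map_mul' g h := by
    have hk : (k : ZMod k.natAbs) = 0 := by
      rw [ZMod.intCast_zmod_eq_zero_iff_dvd]; exact Int.natAbs_dvd.2 dvd_rfl
    simp [hk]

lemma mk_zero_zero_pow (c : ℤ) (n : ℕ) :
    (⟨0, 0, c⟩ : Heisenberg k) ^ n = ⟨0, 0, n * c⟩ := by
  induction n with
  | zero => ext <;> simp
  | succ n ih => rw [pow_succ, ih]; ext <;> simp; ring

lemma mk_zero_zero_mem_center (c : ℤ) : (⟨0, 0, c⟩ : Heisenberg k) ∈ Subgroup.center _ := by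
  rw [Subgroup.mem_center_iff]
  intro g
  ext <;> simp [add_comm]

/-- Commuting with `(1, 0, 0)` forces `k * b = 0`, and commuting with `(0, 1, 0)` forces `k * a =
0`. -/
lemma eq_of_mem_center (hk : k ≠ 0) {g : Heisenberg k} (hg : g ∈ Subgroup.center _) :
    g = ⟨0, 0, g.c⟩ := by
  rw [Subgroup.mem_center_iff] at hg
  have h1 := congrArg Heisenberg.c (hg ⟨1, 0, 0⟩)
  have h2 := congrArg Heisenberg.c (hg ⟨0, 1, 0⟩)
  simp [hk] at h1 h2
  ext <;> simp [h1, h2]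

open scoped commutatorElement in
/-- The `n`-th powers of all central elements are products of commutators exactly when `k`
divides `n`. -/
lemma forall_center_pow_mem_commutator_iff (hk : k ≠ 0) (n : ℕ) :
    (∀ g ∈ Subgroup.center (Heisenberg k), g ^ n ∈ commutator (Heisenberg k)) ↔ k ∣ n := by
  constructor
  · intro h
    -- Reduction modulo `k` has abelian target, so it kills commutators; testing on the central
    -- generator suffices.
    have h1 := Abelianization.commutator_subset_ker (reduceCentral k)
      (h ⟨0, 0, 1⟩ (mk_zero_zero_mem_center 1))
    rw [mk_zero_zero_pow, MonoidHom.mem_ker] at h1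
    have h2 : ((n : ℤ) : ZMod k.natAbs) = 0 := by
      simpa [reduceCentral] using h1
    rw [ZMod.intCast_zmod_eq_zero_iff_dvd] at h2
    exact Int.natAbs_dvd.1 h2
  · rintro ⟨m, hm⟩ g hg
    rw [eq_of_mem_center hk hg, mk_zero_zero_pow]
    have : (⟨0, 0, n * g.c⟩ : Heisenberg k) =
        ⁅(⟨1, 0, 0⟩ : Heisenberg k), (⟨0, m * g.c, 0⟩ : Heisenberg k)⁆ := by
      rw [commutatorElement_def]
      ext <;> simp [hm]; ring
    rw [this]
    exact Subgroup.commutator_mem_commutator (Subgroup.mem_top _) (Subgroup.mem_top _)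

/-- An isomorphism matches centres and commutator subgroups, so the exponent `|k|`, which works on
one side, works on the other and is divisible by `l`. -/
lemma dvd_of_mulEquiv {l : ℤ} (hk : k ≠ 0) (hl : l ≠ 0) (e : Heisenberg k ≃* Heisenberg l) :
    l ∣ k := by
  rw [← Int.dvd_natAbs, ← forall_center_pow_mem_commutator_iff hl]
  intro g hg
  have h := (forall_center_pow_mem_commutator_iff hk k.natAbs).2 (Int.dvd_natAbs.2 dvd_rfl)
    (e.symm g) (by
      rw [Subgroup.mem_center_iff] at hg ⊢
      intro x
      apply e.injective
      simpa using hg (e x))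
  have h' : e.toMonoidHom (e.symm g ^ k.natAbs) ∈ commutator (Heisenberg l) := by
    have := Subgroup.mem_map_of_mem e.toMonoidHom h
    rw [commutator_def, Subgroup.map_commutator] at this
    exact Subgroup.commutator_mono le_top le_top this
  simpa using h'

/-! ### The action on three-space and its quotient -/

/-- Three-dimensional Euclidean space. -/
local notation "ℝ³" => EuclideanSpace ℝ (Fin 3)

noncomputable instance : MulAction (Heisenberg k) ℝ³ where
  smul g p := !₂[g.a + p 0, g.b + p 1, g.c + p 2 + k * g.a * p 1]
  one_smul p := by
    change !₂[_, _, _] = _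
    ext i; fin_cases i <;> simp
  mul_smul g h p := by
    change !₂[_, _, _] = !₂[_, _, _]
    ext i; fin_cases i <;> simp [HSMul.hSMul] <;> ring

@[simp] lemma smul_apply_zero (g : Heisenberg k) (p : ℝ³) : (g • p) 0 = g.a + p 0 := rfl
@[simp] lemma smul_apply_one (g : Heisenberg k) (p : ℝ³) : (g • p) 1 = g.b + p 1 := rfl
@[simp] lemma smul_apply_two (g : Heisenberg k) (p : ℝ³) :
    (g • p) 2 = g.c + p 2 + k * g.a * p 1 := rfl

lemma contDiff_smul (g : Heisenberg k) : ContDiff ℝ ∞ (fun p : ℝ³ => g • p) := by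
  rw [contDiff_euclidean]
  intro i
  fin_cases i <;> simp <;> fun_prop

instance : ContinuousConstSMul (Heisenberg k) ℝ³ := ⟨fun g => (contDiff_smul g).continuous⟩

/-- Freeness: the first two coordinates determine `a` and `b`; once `a` is known, so is the shear,
and the third coordinate gives `c`. -/
instance : IsCancelSMul (Heisenberg k) ℝ³ where
  right_cancel' g h p e := by
    have h0 := congrArg (fun q : ℝ³ => q 0) e
    have h1 := congrArg (fun q : ℝ³ => q 1) e
    have h2 := congrArg (fun q : ℝ³ => q 2) e
    simp at h0 h1 h2
    rw [h0] at h2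
    ext
    · exact h0
    · exact h1
    · simpa using h2

lemma abs_le_of_norm_le {p : ℝ³} {R : ℝ} (h : ‖p‖ ≤ R) (i : Fin 3) : |p i| ≤ R :=
  (PiLp.norm_apply_le p i).trans h

instance : ProperlyDiscontinuousSMul (Heisenberg k) ℝ³ where
  finite_disjoint_inter_image {K L} hK hL := by
    obtain ⟨R, hR⟩ := (hK.union hL).isBounded.exists_norm_le
    -- If `p` and `g • p` both have norm at most `R`, then `|a|, |b| ≤ 2R`, and the shear `k * a * p
    -- 1` adds at most `|k| * 2R * R` to the bound on `c`.
    obtain ⟨N, hN⟩ := exists_nat_ge (2 * R + |(k : ℝ)| * (2 * R) * R)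
    obtain ⟨N', hN'⟩ := exists_nat_ge (2 * R)
    let f : Heisenberg k → ℤ × ℤ × ℤ := fun g => (g.a, g.b, g.c)
    have hf : Function.Injective f := by
      rintro ⟨a, b, c⟩ ⟨a', b', c'⟩ h
      simpa [f] using h
    refine Set.Finite.subset (Set.Finite.preimage hf.injOn
      (Set.finite_Icc ((-N', -N', -N) : ℤ × ℤ × ℤ) (N', N', N))) ?_
    rintro g ⟨_, ⟨p, hp, rfl⟩, hq⟩
    have hp' := abs_le_of_norm_le (hR p (Or.inl hp))
    have hq' := abs_le_of_norm_le (hR _ (Or.inr hq))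
    have a1 := hp' 0
    have a2 := hq' 0
    have b1 := hp' 1
    have b2 := hq' 1
    have c1 := hp' 2
    have c2 := hq' 2
    simp only [smul_apply_zero, smul_apply_one, smul_apply_two] at a2 b2 c2
    have ha : |(g.a : ℝ)| ≤ 2 * R := by
      calc |(g.a : ℝ)| = |(g.a + p 0) - p 0| := by ring_nf
        _ ≤ _ := (abs_sub _ _).trans (by linarith)
    have hb : |(g.b : ℝ)| ≤ 2 * R := by
      calc |(g.b : ℝ)| = |(g.b + p 1) - p 1| := by ring_nf
        _ ≤ _ := (abs_sub _ _).trans (by linarith)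
    have hc : |(g.c : ℝ)| ≤ 2 * R + |(k : ℝ)| * (2 * R) * R := by
      have : |(k : ℝ) * g.a * p 1| ≤ |(k : ℝ)| * (2 * R) * R := by
        rw [abs_mul, abs_mul]
        have hR := (abs_nonneg _).trans a1
        gcongr
      calc |(g.c : ℝ)| = |(g.c + p 2 + k * g.a * p 1) - p 2 - k * g.a * p 1| := by ring_nf
        _ ≤ _ := (abs_sub _ _).trans (by linarith [abs_sub (g.c + p 2 + k * g.a * p 1) (p 2)])
    have key : ∀ (m : ℤ) (n : ℕ) (r : ℝ), |(m : ℝ)| ≤ r → r ≤ n → -(n : ℤ) ≤ m ∧ m ≤ n := by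
      intro m n r h1 h2
      have := abs_le.1 (h1.trans h2)
      exact ⟨by exact_mod_cast this.1, by exact_mod_cast this.2⟩
    have A := key _ _ _ ha hN'
    have B := key _ _ _ hb hN'
    have C := key _ _ _ hc hN
    exact ⟨⟨A.1, B.1, C.1⟩, ⟨A.2, B.2, C.2⟩⟩

end Heisenberg

/-- The Heisenberg nilmanifold with Euler number `k`. -/
abbrev Nilmanifold (k : ℤ) : Type :=
  MulAction.orbitRel.Quotient (Heisenberg k) (EuclideanSpace ℝ (Fin 3))

namespace Nilmanifold

/-- Three-dimensional Euclidean space. -/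
local notation "ℝ³" => EuclideanSpace ℝ (Fin 3)

variable (k : ℤ)

/-- The universal covering of the nilmanifold. -/
noncomputable def proj : EuclideanSpace ℝ (Fin 3) → Nilmanifold k := Quotient.mk _

lemma isQuotientCoveringMap_proj : IsQuotientCoveringMap (proj k) (Heisenberg k) :=
  isQuotientCoveringMap_quotientMk_of_properlyDiscontinuousSMul

lemma proj_smul (g : Heisenberg k) (p : ℝ³) : proj k (g • p) = proj k p :=
  (isQuotientCoveringMap_proj k).map_smul g

variable {k} in
lemma exists_smul_eq {p q : ℝ³} (h : proj k p = proj k q) : ∃ g : Heisenberg k, g • p = q :=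
  (isQuotientCoveringMap_proj k).apply_eq_iff_mem_orbit.1 h.symm

instance : T2Space (Nilmanifold k) := t2Space_of_properlyDiscontinuousSMul_of_t2Space

instance : SecondCountableTopology (Nilmanifold k) :=
  ContinuousConstSMul.secondCountableTopology

instance : ConnectedSpace (Nilmanifold k) :=
  (isQuotientCoveringMap_proj k).surjective.connectedSpace
    (isQuotientCoveringMap_proj k).continuous

instance : CompactSpace (Nilmanifold k) := by
  let S : Set ℝ³ := (EuclideanSpace.equiv (Fin 3) ℝ).symm '' Set.Icc 0 1
  have hS : IsCompact S := isCompact_Icc.image (ContinuousLinearEquiv.continuous _)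
  refine ⟨?_⟩
  rw [show (Set.univ : Set (Nilmanifold k)) = proj k '' S from ?_]
  · exact hS.image (isQuotientCoveringMap_proj k).continuous
  refine (Set.eq_univ_of_forall fun q => ?_).symm
  obtain ⟨p, rfl⟩ := (isQuotientCoveringMap_proj k).surjective q
  -- Moving `p 0` into `[0, 1]` shears the third coordinate by `-k * ⌊p 0⌋ * p 1`; the central entry
  -- is the floor taken after that shear.
  let g : Heisenberg k := ⟨-⌊p 0⌋, -⌊p 1⌋, -⌊p 2 - k * ⌊p 0⌋ * p 1⌋⟩
  refine ⟨g • p, ⟨fun i => (g • p) i, ⟨fun i => ?_, fun i => ?_⟩, ?_⟩, proj_smul k g p⟩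
  · fin_cases i
    · have := Int.floor_le (p 0); simpa [g] using this
    · have := Int.floor_le (p 1); simpa [g] using this
    · have := Int.floor_le (p 2 - k * ⌊p 0⌋ * p 1); simp [g]; linarith
  · fin_cases i
    · have := (Int.lt_floor_add_one (p 0)).le; simp [g]; linarith
    · have := (Int.lt_floor_add_one (p 1)).le; simp [g]; linarith
    · have := (Int.lt_floor_add_one (p 2 - k * ⌊p 0⌋ * p 1)).le; simp [g]; linarith
  · rfl

end Nilmanifold

end ContactSpin

/-! ### The smooth structure of the nilmanifold. -/

namespace ContactSpin

namespace Nilmanifold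

open Topology

variable (k : ℤ)

lemma isLocalHomeomorph_proj : IsLocalHomeomorph (proj k) :=
  (isQuotientCoveringMap_proj k).isCoveringMap.isLocalHomeomorph

variable {k}

lemma exists_eq_localInverseAt {e : OpenPartialHomeomorph (Nilmanifold k) (EuclideanSpace ℝ (Fin 3))}
    (he : e ∈ atlas (EuclideanSpace ℝ (Fin 3)) (Nilmanifold k)) :
    ∃ x, e = (isLocalHomeomorph_proj k).localInverseAt x := by
  obtain ⟨q, rfl⟩ := he
  exact ⟨_, OpenPartialHomeomorph.trans_refl _⟩

/-- Transition maps agree locally with deck transformations, which are smooth. -/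
instance : IsManifold (𝓡 3) ∞ (Nilmanifold k) := by
  apply isManifold_of_contDiffOn
  intro e e' he he'
  obtain ⟨x, rfl⟩ := exists_eq_localInverseAt he
  obtain ⟨y, rfl⟩ := exists_eq_localInverseAt he'
  set L := (isLocalHomeomorph_proj k).localInverseAt x
  set L' := (isLocalHomeomorph_proj k).localInverseAt y
  have hL' : ∀ z ∈ L'.target, L' (proj k z) = z := by
    intro z hz
    have := L'.right_inv hz
    rwa [IsLocalHomeomorph.localInverseAt_symm] at this
  have hLs : ⇑L.symm = proj k := (isLocalHomeomorph_proj k).localInverseAt_symm x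
  rintro z ⟨hz, -⟩
  have hz2 : proj k z ∈ L'.source := by
    have := hz.2
    rw [← hLs]
    simpa using this
  have hpr : proj k (L' (proj k z)) = proj k z :=
    (isLocalHomeomorph_proj k).apply_localInverseAt_of_mem hz2
  -- The two lifts of `proj k z` differ by some `g`. Near `z` the point `g • w` stays in the target
  -- of `L'`, so the transition map is `w ↦ g • w` there.
  obtain ⟨g, hg⟩ := exists_smul_eq hpr.symm
  refine ContDiffAt.contDiffWithinAt ?_
  have hmem : ∀ᶠ w in 𝓝 z, g • w ∈ L'.target := by
    refine (continuous_const_smul g).continuousAt.eventually_mem (L'.open_target.mem_nhds ?_)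
    rw [hg]
    exact L'.map_source hz2
  refine ((Heisenberg.contDiff_smul g).contDiffAt (x := z)).congr_of_eventuallyEq ?_
  filter_upwards [hmem] with w hw
  change L' (L.symm w) = g • w
  rw [hLs, ← proj_smul k g w, hL' _ hw]

lemma extChartAt_symm_eq (q : Nilmanifold k) : ⇑(extChartAt (𝓡 3) q).symm = proj k := by
  ext p
  change (chartAt (EuclideanSpace ℝ (Fin 3)) q).symm p = _
  obtain ⟨x, hx⟩ := exists_eq_localInverseAt (chart_mem_atlas (EuclideanSpace ℝ (Fin 3)) q)
  rw [hx, IsLocalHomeomorph.localInverseAt_symm]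

end Nilmanifold

/-! ### Descent of invariant forms and vector fields along a uniformization. -/

section Developing

variable {E : Type*} [NormedAddCommGroup E] [NormedSpace ℝ E]
  {H : Type*} [TopologicalSpace H] (I : ModelWithCorners ℝ E H)
  {M : Type*} [TopologicalSpace M] [ChartedSpace H M]

/-- `π : E → M` is a uniformization of `M` with deck transformations `G`: it restricts to the
inverse of every preferred chart, and its fibres are the orbits of the smooth maps in `G`. -/
structure IsUniformization (π : E → M) (G : Set (E → E)) : Prop where
  symm_eq (q : M) : ⇑(extChartAt I q).symm = π
  contDiff {g : E → E} (hg : g ∈ G) : ContDiff ℝ ∞ g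
  comp_eq {g : E → E} (hg : g ∈ G) (x : E) : π (g x) = π x
  exists_eq {x y : E} (h : π x = π y) : ∃ g ∈ G, g x = y

/-- The field of covectors on `M` that is given by `α` in the preferred chart at each point. -/
noncomputable def descendForm (α : E → E →L[ℝ] ℝ) : CovectorField I M := fun q => α (extChartAt I q q)

/-- The vector field on `M` that is given by `X` in the preferred chart at each point. -/
noncomputable def descendField (X : E → E) (q : M) : TangentSpace I q := X (extChartAt I q q)

variable {I} {π : E → M} {G : Set (E → E)}

namespace IsUniformization

variable (hπ : IsUniformization I π G)
include hπ

lemma map_extChartAt (q : M) {q' : M} (hq' : q' ∈ (extChartAt I q).source) :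
    π (extChartAt I q q') = q' := by
  rw [← hπ.symm_eq q]; exact (extChartAt I q).left_inv hq'

variable [IsManifold I ∞ M] [I.Boundaryless]

lemma contMDiffAt_of_mem_target (q : M) {x : E} (hx : x ∈ (extChartAt I q).target) :
    ContMDiffAt 𝓘(ℝ, E) I ∞ π x := by
  have := (contMDiffOn_extChartAt_symm (I := I) (n := ∞) q).contMDiffAt
    ((isOpen_extChartAt_target q).mem_nhds hx)
  rwa [hπ.symm_eq] at this

/-- Some deck transformation carries `x` into the target of the chart at `π x`, where `π` is an
inverse chart. -/
lemma contMDiff : ContMDiff 𝓘(ℝ, E) I ∞ π := by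
  intro x
  obtain ⟨g, hg, hgx⟩ := hπ.exists_eq
    (hπ.map_extChartAt (π x) (mem_extChartAt_source (π x))).symm
  have h1 : ContMDiffAt 𝓘(ℝ, E) I ∞ π (g x) := by
    rw [hgx]
    exact hπ.contMDiffAt_of_mem_target (π x) (mem_extChartAt_target _)
  have h2 := ContMDiffAt.comp x h1 (hπ.contDiff hg).contMDiff.contMDiffAt
  rwa [show π ∘ g = π from funext (hπ.comp_eq hg)] at h2

lemma mdifferentiableAt (x : E) : MDifferentiableAt 𝓘(ℝ, E) I π x :=
  hπ.contMDiff.mdifferentiableAt (by simp)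

-- The tangent space at `q` is by construction read in the preferred chart at `q`, so this
-- derivative is the identity of `E`.
omit hπ [IsManifold I ∞ M] [I.Boundaryless] in
lemma mfderiv_extChartAt_self [IsManifold I 1 M] (q : M) :
    mfderiv I 𝓘(ℝ, E) (extChartAt I q) q = ContinuousLinearMap.id ℝ E := by
  have hd : MDifferentiableAt I 𝓘(ℝ, E) (extChartAt I q) q :=
    (contMDiffAt_extChartAt (n := 1)).mdifferentiableAt (by simp)
  have hn : writtenInExtChartAt I 𝓘(ℝ, E) q (extChartAt I q) =ᶠ[nhdsWithin (extChartAt I q q)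
      (Set.range I)] id := by
    filter_upwards [extChartAt_target_mem_nhdsWithin (I := I) q] with y hy
    exact writtenInExtChartAt_extChartAt hy
  refine hd.mfderiv.trans ((hn.fderivWithin_eq (writtenInExtChartAt_extChartAt (mem_extChartAt_target q))).trans ?_)
  exact fderivWithin_id I.uniqueDiffWithinAt_image

/-- On the source of a chart, the derivative of the uniformization inverts that of the chart. -/
lemma mfderiv_comp_mfderiv_extChartAt (q : M) {q' : M} (hq' : q' ∈ (extChartAt I q).source)
    (v : TangentSpace I q') :
    mfderiv 𝓘(ℝ, E) I π (extChartAt I q q') (mfderiv I 𝓘(ℝ, E) (extChartAt I q) q' v) = v := by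
  have : IsManifold I 1 M := IsManifold.of_le (n := ∞) (by simp)
  have h1 : MDifferentiableAt I 𝓘(ℝ, E) (extChartAt I q) q' :=
    mdifferentiableAt_extChartAt (by simpa using hq')
  have h2 := mfderiv_comp q' (hπ.mdifferentiableAt (extChartAt I q q')) h1
  have h3 : π ∘ extChartAt I q =ᶠ[nhds q'] id := by
    filter_upwards [(isOpen_extChartAt_source q).mem_nhds hq'] with w hw
    exact hπ.map_extChartAt q hw
  rw [h3.mfderiv_eq, mfderiv_id] at h2
  exact (congrArg (fun L : E →L[ℝ] E => L v) h2).symm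

lemma mfderiv_extChartAt_self_eq_id (q : M) :
    (mfderiv 𝓘(ℝ, E) I π (extChartAt I q q) : E →L[ℝ] E) = ContinuousLinearMap.id ℝ E := by
  ext v
  have := hπ.mfderiv_comp_mfderiv_extChartAt q (mem_extChartAt_source q) v
  rwa [mfderiv_extChartAt_self] at this

lemma mfderiv_deck {g : E → E} (hg : g ∈ G) (x v : E) :
    (mfderiv 𝓘(ℝ, E) I π (g x) : E →L[ℝ] E) (fderiv ℝ g x v) =
      (mfderiv 𝓘(ℝ, E) I π x : E →L[ℝ] E) v := by
  have h1 : MDifferentiableAt 𝓘(ℝ, E) 𝓘(ℝ, E) g x :=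
    (hπ.contDiff hg).contMDiff.mdifferentiableAt (by simp)
  have h2 := mfderiv_comp x (hπ.mdifferentiableAt (g x)) h1
  rw [show π ∘ g = π from funext (hπ.comp_eq hg), mfderiv_eq_fderiv] at h2
  exact (congrArg (fun L : E →L[ℝ] E => L v) h2).symm

/-- The descended field uses the preferred lift of `π x`, which differs from `x` by a deck
transformation; invariance of `X` makes the choice immaterial. -/
lemma descendField_map {X : E → E} (hX : ∀ g ∈ G, ∀ x, fderiv ℝ g x (X x) = X (g x)) (x : E) :
    mfderiv 𝓘(ℝ, E) I π x (X x) = descendField I X (π x) := by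
  obtain ⟨g, hg, hgx⟩ := hπ.exists_eq
    (hπ.map_extChartAt (π x) (mem_extChartAt_source (π x))).symm
  have h1 := hπ.mfderiv_deck hg x (X x)
  rw [hX g hg, hgx] at h1
  refine h1.symm.trans ?_
  rw [hπ.mfderiv_extChartAt_self_eq_id (π x)]
  rfl

lemma descendForm_map {α : E → E →L[ℝ] ℝ}
    (hα : ∀ g ∈ G, ∀ x v, α (g x) (fderiv ℝ g x v) = α x v) (x v : E) :
    descendForm I α (π x) (mfderiv 𝓘(ℝ, E) I π x v) = α x v := by
  obtain ⟨g, hg, hgx⟩ := hπ.exists_eq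
    (hπ.map_extChartAt (π x) (mem_extChartAt_source (π x))).symm
  have h1 := hπ.mfderiv_deck hg x v
  rw [hgx, hπ.mfderiv_extChartAt_self_eq_id (π x)] at h1
  rw [← hα g hg x v, hgx]
  exact congrArg (α (extChartAt I (π x) (π x))) h1.symm

lemma contMDiff_descendField {X : E → E} (hXs : ContDiff ℝ ∞ X)
    (hX : ∀ g ∈ G, ∀ x, fderiv ℝ g x (X x) = X (g x)) :
    ContMDiff I I.tangent ∞
      (fun q : M => (⟨q, descendField I X q⟩ : TangentBundle I M)) := by
  intro q
  have hT : ContMDiff 𝓘(ℝ, E).tangent I.tangent ∞ (tangentMap 𝓘(ℝ, E) I π) :=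
    hπ.contMDiff.contMDiff_tangentMap (by simp)
  have hS : ContMDiff 𝓘(ℝ, E) 𝓘(ℝ, E).tangent ∞
      (fun x : E => (⟨x, X x⟩ : TangentBundle 𝓘(ℝ, E) E)) := by
    exact contMDiff_vectorSpace_iff_contDiff.2 hXs
  have hφ : ContMDiffAt I 𝓘(ℝ, E) ∞ (extChartAt I q) q := contMDiffAt_extChartAt
  refine ((hT.comp hS).contMDiffAt.comp q hφ).congr_of_eventuallyEq ?_
  filter_upwards [(isOpen_extChartAt_source (I := I) q).mem_nhds (mem_extChartAt_source q)] with w hw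
  have h := hπ.descendField_map hX (extChartAt I q w)
  simp only [Function.comp_apply, tangentMap]
  rw [h, hπ.map_extChartAt q hw]

lemma isSmoothOneForm_descendForm [IsManifold I 1 M] {α : E → E →L[ℝ] ℝ} (hαs : ContDiff ℝ ∞ α)
    (hα : ∀ g ∈ G, ∀ x v, α (g x) (fderiv ℝ g x v) = α x v) :
    IsSmoothOneForm (descendForm I α : CovectorField I M) := by
  intro v₀
  set q := v₀.1
  have hF : ContMDiff 𝓘(ℝ, E).tangent 𝓘(ℝ, ℝ) ∞
      (fun v : TangentBundle 𝓘(ℝ, E) E => α v.1 v.2) := by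
    exact (hαs.contMDiff.comp (Bundle.contMDiff_proj (TangentSpace 𝓘(ℝ, E)))).clm_apply
      (contMDiff_snd_tangentBundle_modelSpace E 𝓘(ℝ, E))
  have hφ : ContMDiffOn I 𝓘(ℝ, E) ∞ (extChartAt I q) (chartAt H q).source :=
    contMDiffOn_extChartAt
  have hT := hφ.contMDiffOn_tangentMapWithin (m := ∞) (by simp)
    (chartAt H q).open_source.uniqueMDiffOn
  have hn : Bundle.TotalSpace.proj ⁻¹' (chartAt H q).source ∈ nhds v₀ :=
    ((chartAt H q).open_source.preimage (FiberBundle.continuous_proj E (TangentSpace I))).mem_nhds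
      (mem_chart_source H q)
  refine (hF.contMDiffAt.comp v₀ (hT.contMDiffAt hn)).congr_of_eventuallyEq ?_
  filter_upwards [hn] with v hv
  have hv' : v.1 ∈ (chartAt H q).source := hv
  have hv'' : v.1 ∈ (extChartAt I q).source := by simpa using hv'
  have h1 := hπ.descendForm_map hα (extChartAt I q v.1) (mfderiv I 𝓘(ℝ, E) (extChartAt I q) v.1 v.2)
  rw [hπ.mfderiv_comp_mfderiv_extChartAt q hv'', hπ.map_extChartAt q hv''] at h1
  simp only [Function.comp_apply, tangentMapWithin]
  rw [mfderivWithin_of_isOpen (chartAt H q).open_source hv']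
  exact h1

lemma chartForm_descendForm {α : E → E →L[ℝ] ℝ}
    (hα : ∀ g ∈ G, ∀ x v, α (g x) (fderiv ℝ g x v) = α x v) (q : M) :
    chartForm (descendForm I α : CovectorField I M) q =
      fun x => ContinuousAlternatingMap.ofSubsingleton ℝ E ℝ (0 : Fin 1) (α x) := by
  funext x
  unfold chartForm
  congr 1
  rw [hπ.symm_eq, I.range_eq_univ, mfderivWithin_univ]
  ext v
  exact hπ.descendForm_map hα x v

/-- In every preferred chart the descended form is `α` itself, so its exterior derivative is
computed in `E`. -/
lemma extDerivAt_descendForm {α : E → E →L[ℝ] ℝ}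
    (hα : ∀ g ∈ G, ∀ x v, α (g x) (fderiv ℝ g x v) = α x v) (q : M) :
    (extDerivAt (descendForm I α : CovectorField I M) q : E [⋀^Fin 2]→L[ℝ] ℝ) =
      extDeriv (fun x => ContinuousAlternatingMap.ofSubsingleton ℝ E ℝ (0 : Fin 1) (α x))
        (extChartAt I q q) := by
  unfold extDerivAt
  rw [hπ.chartForm_descendForm hα, I.range_eq_univ, extDerivWithin_univ, mfderiv_extChartAt_self]
  rfl

end IsUniformization

end Developing

end ContactSpin

/-! ### Nonvanishing of `a ∧ bⁿ` by evaluation on an adapted frame. -/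

namespace ContactSpin

section Wedge

variable {V : Type*} [AddCommGroup V] [Module ℝ V]

/-- The alternatization of `a ⊗ b` is the wedge product of the alternatizations. -/
lemma wedge_alternatization {k l : ℕ} (a : MultilinearMap ℝ (fun _ : Fin k => V) ℝ)
    (b : MultilinearMap ℝ (fun _ : Fin l => V) ℝ) (v : Fin (k + l) → V) :
    wedge (MultilinearMap.alternatization a) (MultilinearMap.alternatization b) v =
      ∑ σ : Equiv.Perm (Fin (k + l)), Equiv.Perm.sign σ •
        (a (fun i => v (σ (Fin.castAdd l i))) * b (fun i => v (σ (Fin.natAdd k i)))) := by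
  rw [wedge, ← MultilinearMap.domCoprod_alternization]
  simp only [AlternatingMap.domDomCongr_apply, LinearMap.compAlternatingMap_apply,
    MultilinearMap.alternatization_apply, map_sum, MultilinearMap.domDomCongr_apply]
  rw [← Equiv.sum_comp (finSumFinEquiv (m := k) (n := l)).permCongr]
  refine Finset.sum_congr rfl fun σ _ => ?_
  rw [Equiv.Perm.sign_permCongr]
  simp only [Units.smul_def, map_zsmul, MultilinearMap.domCoprod_apply, Equiv.permCongr_apply, LinearMap.mul'_apply, Function.comp_apply,
    ← finSumFinEquiv_apply_left, ← finSumFinEquiv_apply_right, Equiv.symm_apply_apply]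

/-- The multilinear map `(v₀, v₁, v₂, …) ↦ B v₀ v₁ * B v₂ v₃ * ⋯` in `2 n` variables. -/
noncomputable def mulPow (B : MultilinearMap ℝ (fun _ : Fin 2 => V) ℝ) :
    (n : ℕ) → MultilinearMap ℝ (fun _ : Fin (2 * n) => V) ℝ
  | 0 => MultilinearMap.constOfIsEmpty ℝ (fun _ : Fin 0 => V) (1 : ℝ)
  | n + 1 => ((LinearMap.mul' ℝ ℝ).compMultilinearMap
      ((mulPow B n).domCoprod B)).domDomCongr finSumFinEquiv

lemma mulPow_succ_apply (B : MultilinearMap ℝ (fun _ : Fin 2 => V) ℝ) (n : ℕ)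
    (v : Fin (2 * (n + 1)) → V) :
    mulPow B (n + 1) v = mulPow B n (fun i => v (Fin.castAdd 2 i)) *
      B (fun i => v (Fin.natAdd (2 * n) i)) := by
  simp [mulPow, MultilinearMap.domCoprod_apply]
  rfl

lemma wedgePow_eq_alternatization (B : MultilinearMap ℝ (fun _ : Fin 2 => V) ℝ) (n : ℕ) :
    wedgePow (MultilinearMap.alternatization B) n = MultilinearMap.alternatization (mulPow B n) := by
  induction n with
  | zero =>
    ext v
    have : Subsingleton (Equiv.Perm (Fin (2 * 0))) :=
      inferInstanceAs (Subsingleton (Equiv.Perm (Fin 0)))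
    rw [MultilinearMap.alternatization_apply, Fintype.sum_subsingleton _ 1]
    simp [wedgePow, mulPow]
  | succ n ih =>
    ext v
    rw [wedgePow, ih, wedge_alternatization, MultilinearMap.alternatization_apply]
    refine Finset.sum_congr rfl fun σ _ => ?_
    rw [MultilinearMap.domDomCongr_apply, mulPow_succ_apply]
    rfl

lemma ofSubsingleton_eq_alternatization (a : V →ₗ[ℝ] ℝ) :
    AlternatingMap.ofSubsingleton ℝ V ℝ (0 : Fin 1) a =
      MultilinearMap.alternatization (MultilinearMap.ofSubsingleton ℝ V ℝ (0 : Fin 1) a) := by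
  ext v
  rw [MultilinearMap.alternatization_apply, Fintype.sum_unique,
    Subsingleton.elim (default : Equiv.Perm (Fin 1)) 1]
  simp

lemma wedge_wedgePow_apply (a : V →ₗ[ℝ] ℝ) (B : MultilinearMap ℝ (fun _ : Fin 2 => V) ℝ) (n : ℕ)
    (v : Fin (1 + 2 * n) → V) :
    wedge (AlternatingMap.ofSubsingleton ℝ V ℝ (0 : Fin 1) a)
        (wedgePow (MultilinearMap.alternatization B) n) v =
      ∑ σ : Equiv.Perm (Fin (1 + 2 * n)), Equiv.Perm.sign σ •
        (a (v (σ 0)) * mulPow B n (fun i => v (σ (Fin.natAdd 1 i)))) := by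
  rw [ofSubsingleton_eq_alternatization, wedgePow_eq_alternatization, wedge_alternatization]
  rfl

/-- A sum over permutations whose nonzero terms belong to even permutations does not vanish. -/
lemma sum_sign_smul_ne_zero {n : ℕ} (f : Equiv.Perm (Fin n) → ℝ) (h1 : 0 < f 1)
    (h0 : ∀ σ, f σ ≠ 0 → 0 < f σ ∧ Equiv.Perm.sign σ = 1) :
    ∑ σ : Equiv.Perm (Fin n), Equiv.Perm.sign σ • f σ ≠ 0 := by
  refine (Finset.sum_pos' (fun σ _ => ?_) ⟨1, Finset.mem_univ _, by simpa using h1⟩).ne'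
  by_cases h : f σ = 0
  · simp [h]
  · obtain ⟨h2, h3⟩ := h0 σ h
    simpa [h3] using h2.le

/-- `B` is not antisymmetric: it is nonzero only on the ordered pair `(1, 2)`. Hence only the
identity permutation contributes to the value on `e`. -/
lemma wedge_wedgePow_one_ne_zero (a : V →ₗ[ℝ] ℝ) (B : MultilinearMap ℝ (fun _ : Fin 2 => V) ℝ)
    (e : Fin 3 → V) (ha0 : 0 < a (e 0)) (ha : ∀ i ≠ 0, a (e i) = 0)
    (hB1 : 0 < B ![e 1, e 2]) (hB0 : ∀ i j, ¬ (i = 1 ∧ j = 2) → B ![e i, e j] = 0) :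
    wedge (AlternatingMap.ofSubsingleton ℝ V ℝ (0 : Fin 1) a)
      (wedgePow (MultilinearMap.alternatization B) 1) ≠ 0 := by
  intro h
  have h1 := congrArg (fun f : V [⋀^Fin (1 + 2 * 1)]→ₗ[ℝ] ℝ => f e) h
  simp only [AlternatingMap.zero_apply] at h1
  rw [wedge_wedgePow_apply] at h1
  have hm : ∀ σ : Equiv.Perm (Fin (1 + 2 * 1)), mulPow B 1 (fun i => e (σ (Fin.natAdd 1 i))) =
      B ![e (σ 1), e (σ 2)] := by
    intro σ
    rw [mulPow_succ_apply, show mulPow B 0 _ = 1 from rfl, one_mul]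
    congr 1
    ext i; fin_cases i <;> rfl
  simp only [hm] at h1
  refine sum_sign_smul_ne_zero _ (mul_pos ha0 hB1) (fun σ hσ => ?_) h1
  have h0 : σ 0 = 0 := by
    by_contra h
    exact hσ (by rw [ha _ h, zero_mul])
  have h12 : σ 1 = 1 ∧ σ 2 = 2 := by
    by_contra h
    exact hσ (by rw [hB0 _ _ h, mul_zero])
  have : σ = 1 := by
    ext i : 1
    fin_cases i
    exacts [h0, h12.1, h12.2]
  subst this
  exact ⟨mul_pos ha0 hB1, by simp⟩

/-- The pairs `(1, 2)`, `(3, 4)`, `(5, 6)` in `Fin 7`. -/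
def IsConsecutivePair (i j : Fin 7) : Prop :=
  (i = 1 ∧ j = 2) ∨ (i = 3 ∧ j = 4) ∨ (i = 5 ∧ j = 6)

instance : DecidableRel IsConsecutivePair := fun i j => by unfold IsConsecutivePair; infer_instance

/-- Such a permutation moves three ordered pairs as blocks, and exchanging two blocks of length two
is even. -/
lemma sign_eq_one_of_isConsecutivePair {σ : Equiv.Perm (Fin 7)} (h0 : σ 0 = 0)
    (h1 : IsConsecutivePair (σ 1) (σ 2)) (h2 : IsConsecutivePair (σ 3) (σ 4))
    (hp : IsConsecutivePair (σ 5) (σ 6)) : Equiv.Perm.sign σ = 1 := by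
  have key : ∀ τ : Equiv.Perm (Fin 7), Equiv.Perm.sign τ = 1 → σ 0 = τ 0 → σ 1 = τ 1 →
      σ 2 = τ 2 → σ 3 = τ 3 → σ 4 = τ 4 → σ 5 = τ 5 → σ 6 = τ 6 → Equiv.Perm.sign σ = 1 := by
    intro τ hτ _ _ _ _ _ _ _
    rw [← hτ]
    congr 1
    ext i : 1
    fin_cases i <;> assumption
  have i13 : σ 1 ≠ σ 3 := σ.injective.ne (by decide)
  have i15 : σ 1 ≠ σ 5 := σ.injective.ne (by decide)
  have i35 : σ 3 ≠ σ 5 := σ.injective.ne (by decide)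
  -- Of the 27 cases, those with a repeated pair contradict injectivity; the remaining six are the
  -- block permutations.
  obtain ⟨h1, h2'⟩ | ⟨h1, h2'⟩ | ⟨h1, h2'⟩ := h1 <;>
  obtain ⟨h3, h4⟩ | ⟨h3, h4⟩ | ⟨h3, h4⟩ := h2 <;>
  obtain ⟨h5, h6⟩ | ⟨h5, h6⟩ | ⟨h5, h6⟩ := hp <;>
  first
  | exact absurd (h1.trans h3.symm) i13
  | exact absurd (h1.trans h5.symm) i15
  | exact absurd (h3.trans h5.symm) i35
  | exact key 1 (by decide) h0 h1 h2' h3 h4 h5 h6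
  | exact key (Equiv.swap 1 3 * Equiv.swap 2 4) (by decide) h0 h1 h2' h3 h4 h5 h6
  | exact key (Equiv.swap 1 5 * Equiv.swap 2 6) (by decide) h0 h1 h2' h3 h4 h5 h6
  | exact key (Equiv.swap 3 5 * Equiv.swap 4 6) (by decide) h0 h1 h2' h3 h4 h5 h6
  | exact key ((Equiv.swap 1 3 * Equiv.swap 2 4) * (Equiv.swap 3 5 * Equiv.swap 4 6)) (by decide)
      h0 h1 h2' h3 h4 h5 h6
  | exact key ((Equiv.swap 3 5 * Equiv.swap 4 6) * (Equiv.swap 1 3 * Equiv.swap 2 4)) (by decide)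
      h0 h1 h2' h3 h4 h5 h6

/-- The surviving permutations are exactly the six block permutations, each contributing a positive
term. -/
lemma wedge_wedgePow_three_ne_zero (a : V →ₗ[ℝ] ℝ) (B : MultilinearMap ℝ (fun _ : Fin 2 => V) ℝ)
    (e : Fin 7 → V) (ha0 : 0 < a (e 0)) (ha : ∀ i ≠ 0, a (e i) = 0)
    (hB1 : ∀ i j, IsConsecutivePair i j → 0 < B ![e i, e j])
    (hB0 : ∀ i j, ¬ IsConsecutivePair i j → B ![e i, e j] = 0) :
    wedge (AlternatingMap.ofSubsingleton ℝ V ℝ (0 : Fin 1) a)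
      (wedgePow (MultilinearMap.alternatization B) 3) ≠ 0 := by
  intro h
  have h1 := (wedge_wedgePow_apply a B 3 e).symm.trans
    (congrArg (fun f : V [⋀^Fin (1 + 2 * 3)]→ₗ[ℝ] ℝ => f e) h)
  have hm : ∀ σ : Equiv.Perm (Fin (1 + 2 * 3)), mulPow B 3 (fun i => e (σ (Fin.natAdd 1 i))) =
      B ![e (σ 1), e (σ 2)] * B ![e (σ 3), e (σ 4)] * B ![e (σ 5), e (σ 6)] := by
    intro σ
    rw [mulPow_succ_apply, mulPow_succ_apply, mulPow_succ_apply, show mulPow B 0 _ = 1 from rfl,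
      one_mul]
    refine congrArg₂ (· * ·) ?_ ?_
    · refine congrArg₂ (· * ·) (congrArg B ?_) (congrArg B ?_) <;>
      · ext i; fin_cases i <;> rfl
    · refine congrArg B ?_
      ext i; fin_cases i <;> rfl
  refine sum_sign_smul_ne_zero (fun σ : Equiv.Perm (Fin 7) => a (e (σ 0)) *
    (B ![e (σ 1), e (σ 2)] * B ![e (σ 3), e (σ 4)] * B ![e (σ 5), e (σ 6)])) (mul_pos ha0 (mul_pos (mul_pos
    (hB1 1 2 (by decide)) (hB1 3 4 (by decide))) (hB1 5 6 (by decide)))) (fun σ hσ => ?_)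
    ((Finset.sum_congr rfl fun σ _ => by rw [← hm]).trans h1)
  have h0 : σ 0 = 0 := by
    by_contra h
    exact hσ (by rw [ha _ h, zero_mul])
  have h12 : IsConsecutivePair (σ 1) (σ 2) := by
    by_contra h
    exact hσ (by rw [hB0 _ _ h]; ring)
  have h34 : IsConsecutivePair (σ 3) (σ 4) := by
    by_contra h
    exact hσ (by rw [hB0 _ _ h]; ring)
  have h56 : IsConsecutivePair (σ 5) (σ 6) := by
    by_contra h
    exact hσ (by rw [hB0 _ _ h]; ring)
  refine ⟨mul_pos ?_ (mul_pos (mul_pos (hB1 _ _ h12) (hB1 _ _ h34)) (hB1 _ _ h56)),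
    sign_eq_one_of_isConsecutivePair h0 h12 h34 h56⟩
  rw [h0]
  exact ha0

end Wedge

end ContactSpin

/-! ### Contact forms from invariant forms; orientations and spin structures from global frames. -/

namespace ContactSpin

section Developing

variable {E : Type*} [NormedAddCommGroup E] [NormedSpace ℝ E]
  {H : Type*} [TopologicalSpace H] {I : ModelWithCorners ℝ E H}
  {M : Type*} [TopologicalSpace M] [ChartedSpace H M] {π : E → M} {G : Set (E → E)}

/-- A bilinear form as a multilinear map in two variables. -/
noncomputable def bilinMultilinear (b : E →L[ℝ] E →L[ℝ] ℝ) :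
    MultilinearMap ℝ (fun _ : Fin 2 => E) ℝ where
  toFun v := b (v 0) (v 1)
  map_update_add' {dec} v i x y := by
    rw [Subsingleton.elim dec inferInstance]
    fin_cases i <;> simp
  map_update_smul' {dec} v i c x := by
    rw [Subsingleton.elim dec inferInstance]
    fin_cases i <;> simp

@[simp] lemma bilinMultilinear_apply (b : E →L[ℝ] E →L[ℝ] ℝ) (v : Fin 2 → E) :
    bilinMultilinear b v = b (v 0) (v 1) := rfl

lemma alternatization_bilinMultilinear_apply (b : E →L[ℝ] E →L[ℝ] ℝ) (v : Fin 2 → E) :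
    MultilinearMap.alternatization (bilinMultilinear b) v = b (v 0) (v 1) - b (v 1) (v 0) := by
  have h : (Finset.univ : Finset (Equiv.Perm (Fin 2))) = {1, Equiv.swap 0 1} := by decide
  rw [MultilinearMap.alternatization_apply, h, Finset.sum_pair (by decide)]
  simp [sub_eq_add_neg]

/-- `dα(v, w) = L v w - L w v`. Keeping the unsymmetrized `L` is what makes the ordered-pair
criteria above applicable. -/
lemma extDeriv_ofSubsingleton {α : E → E →L[ℝ] ℝ} {L : E →L[ℝ] E →L[ℝ] ℝ} {x : E}
    (hL : HasFDerivAt α L x) :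
    (extDeriv (fun x => ContinuousAlternatingMap.ofSubsingleton ℝ E ℝ (0 : Fin 1) (α x)) x
      ).toAlternatingMap = MultilinearMap.alternatization (bilinMultilinear L) := by
  ext v
  have hd : ∀ w : E, fderiv ℝ (fun x => α x w) x = L.flip w := fun w => by
    simpa using (hL.clm_apply (hasFDerivAt_const w x)).fderiv
  have hdiff : DifferentiableAt ℝ
      (fun x => ContinuousAlternatingMap.ofSubsingleton ℝ E ℝ (0 : Fin 1) (α x)) x :=
    (ContinuousAlternatingMap.ofSubsingletonLIE (𝕜 := ℝ) (E := E) (F := ℝ) (0 : Fin 1)).toContinuousLinearEquiv.differentiableAt.comp x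
      hL.differentiableAt
  refine Eq.trans ?_ (alternatization_bilinMultilinear_apply L v).symm
  change extDeriv _ x v = _
  rw [extDeriv_apply hdiff]
  simp [hd, Fin.removeNth, sub_eq_add_neg]

namespace IsUniformization

variable (hπ : IsUniformization I π G) [IsManifold I ∞ M] [I.Boundaryless]
include hπ

lemma isContactForm_descendForm [IsManifold I 1 M] {n : ℕ} (hn : Module.finrank ℝ E = 2 * n + 1)
    {α : E → E →L[ℝ] ℝ} {L : E →L[ℝ] E →L[ℝ] ℝ} (hαs : ContDiff ℝ ∞ α)
    (hL : ∀ x, HasFDerivAt α L x)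
    (hα : ∀ g ∈ G, ∀ x v, α (g x) (fderiv ℝ g x v) = α x v)
    (hw : ∀ x, wedge (AlternatingMap.ofSubsingleton ℝ E ℝ (0 : Fin 1) (α x : E →ₗ[ℝ] ℝ))
      (wedgePow (MultilinearMap.alternatization (bilinMultilinear L)) n) ≠ 0) :
    IsContactForm n (descendForm I α : CovectorField I M) where
  finrank_eq := hn
  smooth := hπ.isSmoothOneForm_descendForm hαs hα
  wedge_ne_zero q := by
    have h := hw (extChartAt I q q)
    rw [← extDeriv_ofSubsingleton (hL _), ← hπ.extDerivAt_descendForm hα q] at h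
    exact h

lemma isLocalFrameOn_descendField {ι : Type*} {X : ι → E → E} (hXs : ∀ i, ContDiff ℝ ∞ (X i))
    (hX : ∀ i, ∀ g ∈ G, ∀ x, fderiv ℝ g x (X i x) = X i (g x))
    (hli : ∀ x, LinearIndependent ℝ (X · x)) (hspan : ∀ x, ⊤ ≤ Submodule.span ℝ (Set.range (X · x))) :
    IsLocalFrameOn (V := fun q : M => TangentSpace I q) I E ∞ (fun i => descendField I (X i))
      Set.univ where
  linearIndependent {q} _ := hli (extChartAt I q q)
  generating {q} _ := hspan (extChartAt I q q)
  contMDiffOn i := (hπ.contMDiff_descendField (hXs i) (hX i)).contMDiffOn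

omit hπ [IsManifold I ∞ M] [I.Boundaryless] in
/-- The product of the uniformization of `M` with a vector space. -/
lemma prod {F : Type*} [NormedAddCommGroup F] [NormedSpace ℝ F] (hπ : IsUniformization I π G) :
    IsUniformization (I.prod 𝓘(ℝ, F)) (Prod.map π (id : F → F))
      ((fun g => Prod.map g (id : F → F)) '' G) where
  symm_eq q := by
    rw [extChartAt_prod]
    simp [← hπ.symm_eq q.1]
    rfl
  contDiff := by
    rintro _ ⟨g, hg, rfl⟩
    exact (hπ.contDiff hg).prodMap contDiff_id
  comp_eq := by
    rintro _ ⟨g, hg, rfl⟩ x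
    exact Prod.ext (hπ.comp_eq hg x.1) rfl
  exists_eq {x y} h := by
    obtain ⟨g, hg, hgx⟩ := hπ.exists_eq (congrArg Prod.fst h)
    exact ⟨_, ⟨g, hg, rfl⟩, Prod.ext hgx (congrArg (Prod.snd : M × F → F) h)⟩

end IsUniformization

variable (I M) in
lemma isOrientable_of_isLocalFrameOn_univ [IsManifold I 1 M] {n : ℕ}
    {s : Fin n → (q : M) → TangentSpace I q}
    (hs : IsLocalFrameOn (V := fun q : M => TangentSpace I q) I E ∞ s Set.univ) :
    IsOrientable I M n :=
  ⟨fun q => (hs.toBasisAt (Set.mem_univ q)).orientation, fun p =>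
    ⟨Set.univ, isOpen_univ, Set.mem_univ p, s, hs, fun q hq =>
      ⟨hs.toBasisAt hq, fun k => by simp, rfl⟩⟩⟩

lemma spinCovers_one (n : ℕ) : SpinCovers (1 : CliffordAlgebra (stdForm n)) 1 := fun v => by simp

end Developing

universe u

variable {E : Type*} [NormedAddCommGroup E] [NormedSpace ℝ E]
  {H : Type*} [TopologicalSpace H] (I : ModelWithCorners ℝ E H)
  (M : Type u) [TopologicalSpace M] [ChartedSpace H M]

/-- A parallelizable manifold admits a spin structure. -/
lemma admitsSpinStructure_of_isLocalFrameOn_univ [IsManifold I 1 M] {n : ℕ}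
    {s : Fin n → (q : M) → TangentSpace I q}
    (hs : IsLocalFrameOn (V := fun q : M => TangentSpace I q) I E ∞ s Set.univ) :
    AdmitsSpinStructure I M n :=
  ⟨{index := PUnit
    U := fun _ => Set.univ
    isOpen_U := fun _ => isOpen_univ
    iUnion_U := Set.iUnion_const _
    frame := fun _ => s
    isLocalFrameOn := fun _ => hs
    lift := fun _ _ _ => 1
    lift_mem := fun _ _ _ _ => one_mem _
    continuousOn_lift := fun _ _ => continuousOn_const
    lift_mul_lift := fun _ _ _ _ _ => one_mul _
    lift_covers := fun _ _ q _ => ⟨1, spinCovers_one n, fun k => by simp [Matrix.one_apply]⟩}⟩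

end ContactSpin

/-! ### Explicit invariant tensors on `ℝ³` and `ℝ³ × ℝ⁴`. -/

namespace ContactSpin

namespace Nilmanifold

/-- Three-dimensional Euclidean space. -/
local notation "ℝ³" => EuclideanSpace ℝ (Fin 3)
/-- Four-dimensional Euclidean space. -/
local notation "ℝ⁴" => EuclideanSpace ℝ (Fin 4)

variable (k : ℤ)

/-- The deck transformations of the universal covering of the nilmanifold. -/
def deck : Set (ℝ³ → ℝ³) := Set.range fun (g : Heisenberg k) (p : ℝ³) => g • p

lemma isUniformization_proj : IsUniformization (𝓡 3) (proj k) (deck k) where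
  symm_eq := extChartAt_symm_eq
  contDiff := by
    rintro _ ⟨g, rfl⟩
    exact Heisenberg.contDiff_smul g
  comp_eq := by
    rintro _ ⟨g, rfl⟩ x
    exact proj_smul k g x
  exists_eq h := by
    obtain ⟨g, hg⟩ := exists_smul_eq h
    exact ⟨_, ⟨g, rfl⟩, hg⟩

/-- The deck transformations of the universal covering of the product of the nilmanifold
with `ℝ⁴`. -/
def deckProd : Set (ℝ³ × ℝ⁴ → ℝ³ × ℝ⁴) := (fun g => Prod.map g (id : ℝ⁴ → ℝ⁴)) '' deck k

lemma isUniformization_prod :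
    IsUniformization ((𝓡 3).prod (𝓡 4)) (Prod.map (proj k) (id : ℝ⁴ → ℝ⁴)) (deckProd k) :=
  (isUniformization_proj k).prod

/-- The derivative of the action of `g` on `ℝ³`. -/
noncomputable def smulDeriv (g : Heisenberg k) : ℝ³ →L[ℝ] ℝ³ :=
  ContinuousLinearMap.id ℝ ℝ³ + ((k * g.a : ℝ) • EuclideanSpace.proj 1).smulRight
    (EuclideanSpace.single 2 1)

lemma hasFDerivAt_smul (g : Heisenberg k) (p : ℝ³) :
    HasFDerivAt (fun p : ℝ³ => g • p) (smulDeriv k g) p := by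
  have h : (fun p : ℝ³ => g • p) = fun p => smulDeriv k g p + g • (0 : ℝ³) := by
    ext p i
    fin_cases i <;> simp [smulDeriv] <;> ring
  rw [h]
  exact (smulDeriv k g).hasFDerivAt.add_const _

lemma hasFDerivAt_smul_prod (g : Heisenberg k) (p : ℝ³ × ℝ⁴) :
    HasFDerivAt (Prod.map (fun p : ℝ³ => g • p) (id : ℝ⁴ → ℝ⁴))
      ((smulDeriv k g).prodMap (ContinuousLinearMap.id ℝ ℝ⁴)) p :=
  (hasFDerivAt_smul k g p.1).prodMap p (hasFDerivAt_id p.2)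

/-! ### Invariant contact forms -/

/-- The derivative of the contact form `dz - k x dy`. -/
noncomputable def contactFormDeriv : ℝ³ →L[ℝ] ℝ³ →L[ℝ] ℝ :=
  (-(k : ℝ) • EuclideanSpace.proj (0 : Fin 3) : ℝ³ →L[ℝ] ℝ).smulRight
    (EuclideanSpace.proj (1 : Fin 3) : ℝ³ →L[ℝ] ℝ)

/-- The left invariant contact form `dz - k x dy` on `ℝ³`. -/
noncomputable def contactForm (p : ℝ³) : ℝ³ →L[ℝ] ℝ :=
  contactFormDeriv k p + (EuclideanSpace.proj (2 : Fin 3) : ℝ³ →L[ℝ] ℝ)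

/-- The derivative of the contact form `dz - k x dy + u₀ du₁ + u₂ du₃`. -/
noncomputable def contactFormProdDeriv : ℝ³ × ℝ⁴ →L[ℝ] ℝ³ × ℝ⁴ →L[ℝ] ℝ :=
  (contactFormDeriv k).bilinearComp (.fst ℝ ℝ³ ℝ⁴) (.fst ℝ ℝ³ ℝ⁴) +
  ((EuclideanSpace.proj (0 : Fin 4) : ℝ⁴ →L[ℝ] ℝ).comp (.snd ℝ ℝ³ ℝ⁴)).smulRight
    ((EuclideanSpace.proj (1 : Fin 4) : ℝ⁴ →L[ℝ] ℝ).comp (.snd ℝ ℝ³ ℝ⁴)) +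
  ((EuclideanSpace.proj (2 : Fin 4) : ℝ⁴ →L[ℝ] ℝ).comp (.snd ℝ ℝ³ ℝ⁴)).smulRight
    ((EuclideanSpace.proj (3 : Fin 4) : ℝ⁴ →L[ℝ] ℝ).comp (.snd ℝ ℝ³ ℝ⁴))

/-- The contact form `dz - k x dy + u₀ du₁ + u₂ du₃` on `ℝ³ × ℝ⁴`. -/
noncomputable def contactFormProd (p : ℝ³ × ℝ⁴) : ℝ³ × ℝ⁴ →L[ℝ] ℝ :=
  contactFormProdDeriv k p + (EuclideanSpace.proj (2 : Fin 3) : ℝ³ →L[ℝ] ℝ).comp (.fst ℝ ℝ³ ℝ⁴)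

lemma contactFormDeriv_apply (v w : ℝ³) : contactFormDeriv k v w = -(k * v 0 * w 1) := by
  simp [contactFormDeriv]

lemma contactForm_apply (p v : ℝ³) : contactForm k p v = v 2 - k * p 0 * v 1 := by
  simp [contactForm, contactFormDeriv_apply]; ring

lemma contactFormProdDeriv_apply (v w : ℝ³ × ℝ⁴) : contactFormProdDeriv k v w =
    -(k * v.1 0 * w.1 1) + v.2 0 * w.2 1 + v.2 2 * w.2 3 := by
  simp [contactFormProdDeriv, contactFormDeriv_apply]

lemma contactFormProd_apply (p v : ℝ³ × ℝ⁴) : contactFormProd k p v =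
    v.1 2 - k * p.1 0 * v.1 1 + p.2 0 * v.2 1 + p.2 2 * v.2 3 := by
  simp [contactFormProd, contactFormProdDeriv_apply]; ring

lemma hasFDerivAt_contactForm (p : ℝ³) :
    HasFDerivAt (contactForm k) (contactFormDeriv k) p :=
  (contactFormDeriv k).hasFDerivAt.add_const _

lemma hasFDerivAt_contactFormProd (p : ℝ³ × ℝ⁴) :
    HasFDerivAt (contactFormProd k) (contactFormProdDeriv k) p :=
  (contactFormProdDeriv k).hasFDerivAt.add_const _

lemma contDiff_contactForm : ContDiff ℝ ∞ (contactForm k) :=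
  (contactFormDeriv k).contDiff.add contDiff_const

lemma contDiff_contactFormProd : ContDiff ℝ ∞ (contactFormProd k) :=
  (contactFormProdDeriv k).contDiff.add contDiff_const

/-- The shear adds `k a dy` to `dz`, and the translation `x ↦ x + a` subtracts the same term through
`-k x dy`. -/
lemma contactForm_invariant : ∀ g ∈ deck k, ∀ x v,
    contactForm k (g x) (fderiv ℝ g x v) = contactForm k x v := by
  rintro _ ⟨g, rfl⟩ x v
  rw [(hasFDerivAt_smul k g x).fderiv]
  simp [contactForm_apply, smulDeriv]
  ring

lemma contactFormProd_invariant : ∀ g ∈ deckProd k, ∀ x v,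
    contactFormProd k (g x) (fderiv ℝ g x v) = contactFormProd k x v := by
  rintro _ ⟨_, ⟨g, rfl⟩, rfl⟩ x v
  rw [(hasFDerivAt_smul_prod k g x).fderiv]
  simp [contactFormProd_apply, smulDeriv]
  ring

variable {k}

lemma isContactForm (hk : 0 < k) :
    IsContactForm 1 (descendForm (𝓡 3) (contactForm k) : CovectorField (𝓡 3) (Nilmanifold k)) := by
  refine (isUniformization_proj k).isContactForm_descendForm (by simp)
    (contDiff_contactForm k) (hasFDerivAt_contactForm k) (contactForm_invariant k) fun x => ?_
  -- The frame is `∂z, -∂x, ∂y + k x ∂z`, the last two in the kernel of `α`; the sign of `-∂x` turns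
  -- the pairing into `k > 0`.
  refine wedge_wedgePow_one_ne_zero _ _
    ![!₂[0, 0, 1], !₂[-1, 0, 0], !₂[0, 1, k * x 0]] ?_ ?_ ?_ ?_
  · simp [contactForm_apply]
  · intro i hi
    fin_cases i <;> simp [contactForm_apply] at hi ⊢
  · simpa [contactFormDeriv_apply] using hk
  · intro i j
    fin_cases i <;> fin_cases j <;> simp [contactFormDeriv_apply]

lemma isContactForm_prod (hk : 0 < k) :
    IsContactForm 3 (descendForm ((𝓡 3).prod (𝓡 4)) (contactFormProd k) :
      CovectorField ((𝓡 3).prod (𝓡 4)) (Nilmanifold k × ℝ⁴)) := by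
  refine (isUniformization_prod k).isContactForm_descendForm (by simp)
    (contDiff_contactFormProd k) (hasFDerivAt_contactFormProd k) (contactFormProd_invariant k)
    fun x => ?_
  -- The same three vectors, followed by `∂u₀, ∂u₁ - u₀ ∂z, ∂u₂, ∂u₃ - u₂ ∂z`; the `∂z` corrections
  -- put them in the kernel of `β`.
  refine wedge_wedgePow_three_ne_zero _ _
    ![(!₂[0, 0, 1], 0), (!₂[-1, 0, 0], 0), (!₂[0, 1, k * x.1 0], 0), (0, !₂[1, 0, 0, 0]),
      (!₂[0, 0, -x.2 0], !₂[0, 1, 0, 0]), (0, !₂[0, 0, 1, 0]),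
      (!₂[0, 0, -x.2 2], !₂[0, 0, 0, 1])] ?_ ?_ ?_ ?_
  · simp [contactFormProd_apply]
  · intro i hi
    fin_cases i <;> simp [contactFormProd_apply] at hi ⊢
  · rintro i j (⟨rfl, rfl⟩ | ⟨rfl, rfl⟩ | ⟨rfl, rfl⟩)
    · simpa [contactFormProdDeriv_apply] using hk
    · simp [contactFormProdDeriv_apply]
    · simp [contactFormProdDeriv_apply]
  · intro i j
    fin_cases i <;> fin_cases j <;> simp [contactFormProdDeriv_apply, IsConsecutivePair]

/-! ### Invariant frames -/

variable (k)

/-- The left invariant frame `∂x, ∂y + k x ∂z, ∂z` on `ℝ³`. -/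
noncomputable def frame (i : Fin 3) (p : ℝ³) : ℝ³ :=
  ![!₂[1, 0, 0], !₂[0, 1, k * p 0], !₂[0, 0, 1]] i

/-- The frame on `ℝ³ × ℝ⁴` made of the left invariant frame of `ℝ³` and the standard frame
of `ℝ⁴`. -/
noncomputable def frameProd (i : Fin (3 + 4)) (p : ℝ³ × ℝ⁴) : ℝ³ × ℝ⁴ :=
  Fin.addCases (fun i => (frame k i p.1, 0)) (fun j => (0, EuclideanSpace.single j 1)) i

lemma contDiff_frame (i : Fin 3) : ContDiff ℝ ∞ (frame k i) := by
  rw [contDiff_euclidean]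
  intro j
  fin_cases i <;> fin_cases j <;> simp [frame] <;> fun_prop

lemma contDiff_frameProd (i : Fin (3 + 4)) : ContDiff ℝ ∞ (frameProd k i) := by
  induction i using Fin.addCases with
  | left i =>
    rw [show frameProd k (Fin.castAdd 4 i) = fun p => (frame k i p.1, 0) by
      funext p; simp [frameProd]]
    exact ((contDiff_frame k i).comp contDiff_fst).prodMk contDiff_const
  | right j =>
    rw [show frameProd k (Fin.natAdd 3 j) = fun _ => (0, EuclideanSpace.single j 1) by
      funext p; simp [frameProd]]
    exact contDiff_const

lemma frame_invariant (i : Fin 3) : ∀ g ∈ deck k, ∀ x,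
    fderiv ℝ g x (frame k i x) = frame k i (g x) := by
  rintro _ ⟨g, rfl⟩ x
  rw [(hasFDerivAt_smul k g x).fderiv]
  ext j
  fin_cases i <;> fin_cases j <;> simp [frame, smulDeriv]
  ring

lemma frameProd_invariant (i : Fin (3 + 4)) : ∀ g ∈ deckProd k, ∀ x,
    fderiv ℝ g x (frameProd k i x) = frameProd k i (g x) := by
  rintro _ ⟨_, ⟨g, rfl⟩, rfl⟩ x
  have h := fun i => frame_invariant k i _ ⟨g, rfl⟩ x.1
  simp only [(hasFDerivAt_smul k g x.1).fderiv] at h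
  rw [(hasFDerivAt_smul_prod k g x).fderiv]
  induction i using Fin.addCases with
  | left i => simp [frameProd, h]
  | right j => simp [frameProd]

lemma linearIndependent_frame (p : ℝ³) : LinearIndependent ℝ (frame k · p) := by
  rw [Fintype.linearIndependent_iff]
  intro c hc
  have h0 := congrArg (fun v : ℝ³ => v 0) hc
  have h1 := congrArg (fun v : ℝ³ => v 1) hc
  have h2 := congrArg (fun v : ℝ³ => v 2) hc
  simp [Fin.sum_univ_three, frame] at h0 h1 h2
  simp [h1] at h2
  intro i
  fin_cases i <;> assumption

lemma linearIndependent_frameProd (p : ℝ³ × ℝ⁴) : LinearIndependent ℝ (frameProd k · p) := by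
  rw [Fintype.linearIndependent_iff]
  intro c hc
  rw [Fin.sum_univ_add] at hc
  have h1 := congrArg Prod.fst hc
  have h2 := congrArg Prod.snd hc
  simp [frameProd, Prod.fst_sum, Prod.snd_sum] at h1 h2
  intro i
  induction i using Fin.addCases with
  | left i => exact Fintype.linearIndependent_iff.1 (linearIndependent_frame k p.1) _ h1 i
  | right j =>
    simpa [Finset.sum_apply, Pi.single_apply] using congrArg (fun v : ℝ⁴ => v j) h2

lemma isLocalFrameOn_frame :
    IsLocalFrameOn (V := fun q : Nilmanifold k => TangentSpace (𝓡 3) q) (𝓡 3) ℝ³ ∞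
      (fun i => descendField (𝓡 3) (frame k i)) Set.univ :=
  (isUniformization_proj k).isLocalFrameOn_descendField (contDiff_frame k) (frame_invariant k)
    (linearIndependent_frame k) fun p =>
      ((linearIndependent_frame k p).span_eq_top_of_card_eq_finrank (by simp)).ge

lemma isLocalFrameOn_frameProd :
    IsLocalFrameOn (V := fun q : Nilmanifold k × ℝ⁴ => TangentSpace ((𝓡 3).prod (𝓡 4)) q)
      ((𝓡 3).prod (𝓡 4)) (ℝ³ × ℝ⁴) ∞
      (fun i => descendField ((𝓡 3).prod (𝓡 4)) (frameProd k i)) Set.univ :=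
  (isUniformization_prod k).isLocalFrameOn_descendField (contDiff_frameProd k)
    (frameProd_invariant k) (linearIndependent_frameProd k) fun p =>
      ((linearIndependent_frameProd k p).span_eq_top_of_card_eq_finrank (by simp)).ge

end Nilmanifold

end ContactSpin

/-! ### Distinguishing the products, and the zero section. -/

namespace ContactSpin

namespace Nilmanifold

/-- Three-dimensional Euclidean space. -/
local notation "ℝ³" => EuclideanSpace ℝ (Fin 3)
/-- Four-dimensional Euclidean space. -/
local notation "ℝ⁴" => EuclideanSpace ℝ (Fin 4)

variable {k l : ℤ}

/-- The action of the Heisenberg group on the first factor of `ℝ³ × ℝ⁴`. -/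
@[reducible]
noncomputable def prodMulAction (k : ℤ) : MulAction (Heisenberg k) (ℝ³ × ℝ⁴) where
  smul g p := (g • p.1, p.2)
  one_smul p := Prod.ext (one_smul _ p.1) rfl
  mul_smul g h p := Prod.ext (mul_smul g h p.1) rfl

attribute [local instance] prodMulAction

lemma isQuotientCoveringMap_prod (k : ℤ) :
    IsQuotientCoveringMap (Prod.map (proj k) (id : ℝ⁴ → ℝ⁴)) (Heisenberg k) := by
  have h := isQuotientCoveringMap_proj k
  refine { toIsQuotientMap := (h.isOpenQuotientMap.prodMap .id).isQuotientMap
           continuous_const_smul := fun g =>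
             ((continuous_const_smul g).comp continuous_fst).prodMk continuous_snd
           apply_eq_iff_mem_orbit := fun {e₁ e₂} => ⟨fun he => ?_, ?_⟩
           disjoint := fun e => ?_ }
  · obtain ⟨g, hg⟩ := h.apply_eq_iff_mem_orbit.1 (congrArg (Prod.fst : Nilmanifold k × ℝ⁴ → _) he)
    exact ⟨g, Prod.ext hg (congrArg (Prod.snd : Nilmanifold k × ℝ⁴ → _) he).symm⟩
  · rintro ⟨g, rfl⟩
    exact Prod.ext (proj_smul k g e₂.1) rfl
  · obtain ⟨U, hU, hU'⟩ := h.disjoint e.1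
    refine ⟨Prod.fst ⁻¹' U, continuous_fst.continuousAt.preimage_mem_nhds hU, fun g => ?_⟩
    rintro ⟨_, ⟨p, hp, rfl⟩, hp'⟩
    exact hU' g ⟨_, ⟨p.1, hp, rfl⟩, hp'⟩

/-- A homeomorphism between products of nilmanifolds with `ℝ⁴` induces an isomorphism of the
groups of deck transformations of their universal coverings. -/
lemma nonempty_mulEquiv_of_homeomorph (φ : Nilmanifold k × ℝ⁴ ≃ₜ Nilmanifold l × ℝ⁴) :
    Nonempty (Heisenberg k ≃* Heisenberg l) := by
  -- After composition with `φ`, both coverings have the same base and simply connected total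
  -- spaces, so both deck groups are identified with its `π₁`, up to passing to opposite groups.
  have h1 := (isQuotientCoveringMap_prod k).homeomorph_comp φ
  have h2 := isQuotientCoveringMap_prod l
  let x := Prod.map (proj l) (id : ℝ⁴ → ℝ⁴) 0
  obtain ⟨e, he⟩ := h1.surjective x
  exact ⟨MulEquiv.op.symm ((h1.fundamentalGroupEquiv ⟨e, he⟩).symm.trans
    (h2.fundamentalGroupEquiv (x := x) ⟨0, rfl⟩))⟩

lemma eq_of_homeomorph (hk : 0 < k) (hl : 0 < l)
    (φ : Nilmanifold k × ℝ⁴ ≃ₜ Nilmanifold l × ℝ⁴) : k = l := by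
  obtain ⟨e⟩ := nonempty_mulEquiv_of_homeomorph φ
  exact Int.dvd_antisymm hk.le hl.le (Heisenberg.dvd_of_mulEquiv hl.ne' hk.ne' e.symm)
    (Heisenberg.dvd_of_mulEquiv hk.ne' hl.ne' e)

/-- The zero section is a smooth embedding. -/
lemma isSmoothEmbedding_prodMk_zero (k : ℤ) :
    Manifold.IsSmoothEmbedding (𝓡 3) ((𝓡 3).prod (𝓡 4)) ∞
      (fun y : Nilmanifold k => (y, (0 : ℝ⁴))) := by
  refine ⟨⟨ℝ⁴, inferInstance, inferInstance, fun y => ?_⟩, isEmbedding_prodMkLeft 0⟩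
  refine .mk_of_continuousAt (by fun_prop) (.refl ℝ (ℝ³ × ℝ⁴)) (chartAt _ y) (chartAt _ (y, 0))
    (mem_chart_source _ _) (mem_chart_source _ _) (IsManifold.chart_mem_maximalAtlas _)
    (IsManifold.chart_mem_maximalAtlas _) fun v hv => ?_
  exact Prod.ext (((chartAt ℝ³ y).extend (𝓡 3)).right_inv hv) rfl

/-- At `u = 0` the coefficients `u₀` and `u₂` vanish, so `β` pulls back to `α`. -/
lemma isCoorientedContactSubmanifold_zero (hk : 0 < k) :
    IsCoorientedContactSubmanifold (I := (𝓡 3).prod (𝓡 4)) (J := 𝓡 3) 1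
      (fun p => LinearMap.ker (descendForm ((𝓡 3).prod (𝓡 4)) (contactFormProd k) p :
        TangentSpace ((𝓡 3).prod (𝓡 4)) p →ₗ[ℝ] ℝ))
      (fun y : Nilmanifold k => (y, (0 : ℝ⁴))) := by
  refine ⟨isSmoothEmbedding_prodMk_zero k, descendForm (𝓡 3) (contactForm k), isContactForm hk,
    fun y => ?_⟩
  have h : mfderiv (𝓡 3) ((𝓡 3).prod (𝓡 4)) (fun y : Nilmanifold k => (y, (0 : ℝ⁴))) y =
    ContinuousLinearMap.inl ℝ ℝ³ ℝ⁴ := mfderiv_prod_left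
  ext v
  have hv : (mfderiv (𝓡 3) ((𝓡 3).prod (𝓡 4)) (fun y : Nilmanifold k => (y, (0 : ℝ⁴))) y :
    ℝ³ →L[ℝ] ℝ³ × ℝ⁴) v = (v, 0) := congrArg (fun L : ℝ³ →L[ℝ] ℝ³ × ℝ⁴ => L v) h
  change contactFormProd k (extChartAt (𝓡 3) y y, 0) _ = 0 ↔
    contactForm k (extChartAt (𝓡 3) y y) v = 0
  refine (Eq.congr_left ((congrArg (contactFormProd k (extChartAt (𝓡 3) y y, 0)) hv).trans
    ((contactFormProd_apply k _ _).trans ?_)))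
  refine Eq.trans ?_ (contactForm_apply k (extChartAt (𝓡 3) y y) v).symm
  simp

/-- The scaling homotopy from the projection onto the zero section to the identity. -/
lemma homotopicRel_zeroSection {X : Type*} [TopologicalSpace X] (f : C(X, X × ℝ⁴))
    (r : C(X × ℝ⁴, X)) (hf : ∀ x, f x = (x, 0)) (hr : ∀ p, r p = p.1) :
    (ContinuousMap.id (X × ℝ⁴)).HomotopicRel (f.comp r) (Set.range f) := by
  -- The factor `1 - t` gives the identity at time 0 and the retraction at time 1.
  refine ⟨{ toFun := fun p => (p.2.1, (1 - (p.1 : ℝ)) • p.2.2)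
            continuous_toFun := by fun_prop
            map_zero_left := fun p => by simp
            map_one_left := fun p => by simp [hf, hr]
            prop' := ?_ }⟩
  rintro t _ ⟨x, rfl⟩
  simp [hf]

end Nilmanifold

end ContactSpin

theorem theorem3p5 :
    ∃ (Y : ℕ → Type) (_ : ∀ i, TopologicalSpace (Y i))
      (_ : ∀ i, ChartedSpace (EuclideanSpace ℝ (Fin 3)) (Y i))
      (_ : ∀ i, IsManifold (𝓡 3) ∞ (Y i)),
      (∀ i, T2Space (Y i) ∧ SecondCountableTopology (Y i) ∧ ConnectedSpace (Y i) ∧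
        CompactSpace (Y i) ∧ ContactSpin.IsOrientable (𝓡 3) (Y i) 3) ∧
      (Pairwise fun i j => IsEmpty
        ((Y i × EuclideanSpace ℝ (Fin 4)) ≃ₜ (Y j × EuclideanSpace ℝ (Fin 4)))) ∧
      ∀ i, NoncompactSpace (Y i × EuclideanSpace ℝ (Fin 4)) ∧
        ContactSpin.AdmitsSpinStructure ((𝓡 3).prod (𝓡 4)) (Y i × EuclideanSpace ℝ (Fin 4)) 7 ∧
        ∃ ξ : (p : Y i × EuclideanSpace ℝ (Fin 4)) →
            Submodule ℝ (TangentSpace ((𝓡 3).prod (𝓡 4)) p),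
          ContactSpin.IsCoorientedContactStructure 3 ξ ∧
          ContactSpin.IsCoorientedContactSubmanifold (J := 𝓡 3) 1 ξ
            (fun y : Y i => (y, (0 : EuclideanSpace ℝ (Fin 4)))) ∧
          ∃ (f : C(Y i, Y i × EuclideanSpace ℝ (Fin 4)))
            (r : C(Y i × EuclideanSpace ℝ (Fin 4), Y i)),
            (∀ y, f y = (y, 0)) ∧ (∀ y, r (f y) = y) ∧
            ContMDiff ((𝓡 3).prod (𝓡 4)) (𝓡 3) ∞ r ∧
            (ContinuousMap.id (Y i × EuclideanSpace ℝ (Fin 4))).HomotopicRel (f.comp r)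
              (Set.range f) := by
  -- The shift by one avoids `k = 0`, where the group is abelian and `dz` is not contact.
  have hk (i : ℕ) : 0 < (i + 1 : ℤ) := by positivity
  refine ⟨fun i => ContactSpin.Nilmanifold (i + 1), fun _ => inferInstance, fun _ => inferInstance,
    fun _ => inferInstance, fun i => ⟨inferInstance, inferInstance, inferInstance, inferInstance,
      ContactSpin.isOrientable_of_isLocalFrameOn_univ _ _ (ContactSpin.Nilmanifold.isLocalFrameOn_frame _)⟩,
    fun i j hij => ⟨fun φ => hij ?_⟩, fun i => ⟨inferInstance,
      ContactSpin.admitsSpinStructure_of_isLocalFrameOn_univ _ _ (ContactSpin.Nilmanifold.isLocalFrameOn_frameProd _),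
      _, ⟨_, ContactSpin.Nilmanifold.isContactForm_prod (hk i), fun _ => rfl⟩,
      ContactSpin.Nilmanifold.isCoorientedContactSubmanifold_zero (hk i),
      ⟨fun y => (y, 0), by fun_prop⟩, ⟨Prod.fst, continuous_fst⟩, fun _ => rfl, fun _ => rfl,
      contMDiff_fst, ContactSpin.Nilmanifold.homotopicRel_zeroSection _ _ (fun _ => rfl) (fun _ => rfl)⟩⟩
  have := ContactSpin.Nilmanifold.eq_of_homeomorph (hk i) (hk j) φ
  omega
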